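/- Let $X\in\mathbb{R}^{n\times p}$ be a fixed matrix with $\operatorname{rank}(X)=p\ge 1$, let $\beta_0\in\mathbb{R}^p$, $\sigma_0>0$, $k\ge 0$. For an $n\times n$ permutation matrix $\Pi$ let $d(\Pi,I_n)=\#\{i:\Pi_{ii}=0\}$, let $\mathcal{P}_{n,k}$ be the set of permutation matrices with $d(\Pi,I_n)\le k$, and let $\Pi_0\in\mathcal{P}_{n,k}$. For a matrix $A$ with $n$ rows, $M_A$ denotes the orthogonal projection matrix of $\mathbb{R}^n$ onto the range of $A$. Let $U,U_1,U_2,\dots$ be independent $\mathrm{N}(0,I_n)$ vectors, let $Y=\Pi_0X\beta_0+\sigma_0U$ be the observed response, let $$\hat\Pi_\ell\in\operatorname*{arg\,min}_{\Pi\in\mathcal{P}_{n,k}}\bigl\|(I_n-M_{(\Pi X,\,U_\ell)})Y\bigr\|_2^2 ,\qquad \mathcal{C}^{(L)}=\{\hat\Pi_\ell:\ell=1,\dots,L\},$$ where $(\Pi X,U_\ell)$ is the matrix $\Pi X$ with the extra column $U_\ell$ and $\hat\Pi_\ell$ is chosen by an arbitrary fixed rule that assigns a minimizer to each value of $(Y,U_\ell)$.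 Put $$C_{\min}(\Pi_0)=\min_{\Pi\in\mathcal{P}_{n,k},\,\Pi\ne\Pi_0}\frac{\|(I_n-\Pi M_X\Pi^\top)\Pi_0X\beta_0\|_2^2}{n\max(d(\Pi_0,I_n)-d(\Pi,I_n),1)}$$ (equal to $+\infty$ if there is no such $\Pi$), $$T(y,(\Pi,\beta))=\frac{(y-\Pi X\beta)^\top M_{\Pi X}(y-\Pi X\beta)/p}{(y-\Pi X\beta)^\top(I_n-M_{\Pi X})(y-\Pi X\beta)/(n-p)},$$ and, for $\alpha\in(0,1)$, $$\Gamma_\alpha^{\mathrm{coef}}(Y)=\bigcup_{\Pi\in\mathcal{C}^{(L)}}\bigl\{\beta\in\mathbb{R}^p: T(Y,(\Pi,\beta))\le F^{-1}_{p,n-p}(\alpha)\bigr\},$$ where $F^{-1}_{p,n-p}$ is the quantile function of the $F$ distribution with $(p,n-p)$ degrees of freedom. Suppose that $C_{\min}(\Pi_0)>0$ and $n>p+1$. Then there is a sequence $(\delta_L)_{L\in\mathbb{N}}$ of positive reals, not depending on $\alpha$ or on the choice of minimizers, such that $$\delta_L=O\!\left(\frac{(\log L)^{(n-p)/2}}{L^{(n-p-1)/(2(n-1))}}\right)\quad(L\to\infty),\qquad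 \mathbb{P}\bigl(\Pi_0\notin\mathcal{C}^{(L)}\bigr)\le\delta_L\quad\text{for all }L\ge 2,$$ and, for all $L\ge 1$ and all $\alpha\in(0,1)$, $$\mathbb{P}\bigl(\beta_0\in\Gamma_\alpha^{\mathrm{coef}}(Y)\bigr)\ge\alpha-\delta_L .$$ Here $\mathbb{P}$ is the joint law of $(U_1,\dots,U_L)$ and $U$. -/

import Mathlib

open MeasureTheory ProbabilityTheory Filter Asymptotics

noncomputable section

namespace PermutedRegression

/-- Orthogonal projection matrix `M_A` of `ℝⁿ` onto the range (column space) of `A`,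
with no rank assumption on `A`. -/
def projMatrix {n : ℕ} {ι : Type} [Fintype ι] [DecidableEq ι] (A : Matrix (Fin n) ι ℝ) :
    Matrix (Fin n) (Fin n) ℝ :=
  Matrix.toEuclideanLin.symm
    ((LinearMap.range (Matrix.toEuclideanLin A)).starProjection.toLinearMap)

/-- Squared Euclidean norm `‖v‖₂²` of `v ∈ ℝⁿ`. -/
def sqNorm {n : ℕ} (v : Fin n → ℝ) : ℝ := ∑ i, v i ^ 2

/-- Number of mismatches `d(Π, I_n)`: the number of zero diagonal entries of the permutation
matrix `Π` of `π`. Permutation matrices are indexed by permutations `π` through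
`Equiv.Perm.permMatrix`, which is a bijection. -/
def mismatches {n : ℕ} (π : Equiv.Perm (Fin n)) : ℕ :=
  Set.ncard {i : Fin n | π.permMatrix ℝ i i = 0}

/-- The set of `k`-sparse permutations. -/
def sparsePerms (n k : ℕ) : Set (Equiv.Perm (Fin n)) := {π | mismatches π ≤ k}

/-- The row-permuted design `Π X`. -/
def permDesign {n p : ℕ} (π : Equiv.Perm (Fin n)) (X : Matrix (Fin n) (Fin p) ℝ) :
    Matrix (Fin n) (Fin p) ℝ :=
  π.permMatrix ℝ * X

/-- The augmented matrix `(Π X, u)`, of size `n × (p + 1)`. -/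
def augDesign {n p : ℕ} (π : Equiv.Perm (Fin n)) (X : Matrix (Fin n) (Fin p) ℝ)
    (u : Fin n → ℝ) : Matrix (Fin n) (Fin p ⊕ Unit) ℝ :=
  Matrix.fromCols (permDesign π X) (Matrix.replicateCol Unit u)

/-- The response `Y = Π X β + σ u`. -/
def response {n p : ℕ} (X : Matrix (Fin n) (Fin p) ℝ) (π : Equiv.Perm (Fin n))
    (β : Fin p → ℝ) (σ : ℝ) (u : Fin n → ℝ) : Fin n → ℝ :=
  (permDesign π X).mulVec β + σ • u

/-- The least squares objective `‖(I_n - M_{(Π X, u)}) y‖₂²`. -/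
def objective {n p : ℕ} (X : Matrix (Fin n) (Fin p) ℝ) (y u : Fin n → ℝ)
    (π : Equiv.Perm (Fin n)) : ℝ :=
  sqNorm ((1 - projMatrix (augDesign π X u)).mulVec y)

/-- `sel y u` is, for every response `y` and every artificial noise `u`, a minimizer of the
least squares objective over the `k`-sparse permutations (ties are broken arbitrarily). -/
def IsArgminRule {n p : ℕ} (X : Matrix (Fin n) (Fin p) ℝ) (k : ℕ)
    (sel : (Fin n → ℝ) → (Fin n → ℝ) → Equiv.Perm (Fin n)) : Prop :=
  ∀ y u, sel y u ∈ sparsePerms n k ∧ IsMinOn (objective X y u) (sparsePerms n k) (sel y u)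

/-- The candidate set built from the artificial noise vectors `us 1, …, us L`. -/
def candidateSet {n L : ℕ} (sel : (Fin n → ℝ) → (Fin n → ℝ) → Equiv.Perm (Fin n))
    (y : Fin n → ℝ) (us : Fin L → Fin n → ℝ) : Set (Equiv.Perm (Fin n)) :=
  Set.range fun l => sel y (us l)

/-- The separation constant `C_min(Π₀)`. The minimum over an empty set is `+∞`. -/
def Cmin {n p : ℕ} (X : Matrix (Fin n) (Fin p) ℝ) (k : ℕ) (π₀ : Equiv.Perm (Fin n))
    (β₀ : Fin p → ℝ) : EReal :=
  ⨅ π ∈ sparsePerms n k \ {π₀},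
    ((sqNorm ((1 - π.permMatrix ℝ * projMatrix X * (π.permMatrix ℝ).transpose).mulVec
        ((permDesign π₀ X).mulVec β₀)) /
      (n * max ((mismatches π₀ : ℝ) - (mismatches π : ℝ)) 1) : ℝ) : EReal)

/-- The statistic `T(y, (Π, β))`. -/
def statT {n p : ℕ} (X : Matrix (Fin n) (Fin p) ℝ) (y : Fin n → ℝ)
    (π : Equiv.Perm (Fin n)) (β : Fin p → ℝ) : ℝ :=
  let r := y - (permDesign π X).mulVec β
  let M := projMatrix (permDesign π X)
  (r ⬝ᵥ M.mulVec r / p) / (r ⬝ᵥ (1 - M).mulVec r / ((n : ℝ) - p))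

/-- The standard Gaussian law `N(0, I_n)` on `ℝⁿ`. -/
def stdNormal (n : ℕ) : Measure (Fin n → ℝ) := Measure.pi fun _ => gaussianReal 0 1

/-- The `F` distribution with `(a, b)` degrees of freedom: the law of
`(‖Z‖₂² / a) / (‖W‖₂² / b)`, `Z ∼ N(0, I_a)` and `W ∼ N(0, I_b)` independent. -/
def fDist (a b : ℕ) : Measure ℝ :=
  ((stdNormal a).prod (stdNormal b)).map fun z => (sqNorm z.1 / a) / (sqNorm z.2 / b)

/-- Quantile function of a probability law `μ` on `ℝ` (at levels in `(0, 1)`). -/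
def quantile (μ : Measure ℝ) (α : ℝ) : ℝ := sInf {x : ℝ | α ≤ μ.real (Set.Iic x)}

/-- The confidence set for `β`: the union over the candidate permutations `Π ∈ C` of
`{β | T(y, (Π, β)) ≤ F⁻¹_{p,n-p}(α)}`. -/
def coefRegion {n p : ℕ} (X : Matrix (Fin n) (Fin p) ℝ) (α : ℝ) (y : Fin n → ℝ)
    (C : Set (Equiv.Perm (Fin n))) : Set (Fin p → ℝ) :=
  ⋃ π ∈ C, {β | statT X y π β ≤ quantile (fDist p (n - p)) α}

/-- Joint law of `(𝒰^L, U)`: `L` artificial noise vectors and the noise of the observation,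
all independent with law `N(0, I_n)`. -/
def jointLaw (n L : ℕ) : Measure ((Fin L → Fin n → ℝ) × (Fin n → ℝ)) :=
  (Measure.pi fun _ : Fin L => stdNormal n).prod (stdNormal n)

end PermutedRegression

end

noncomputable section

namespace PermutedRegression

/-! Write `z = Π₀Xβ₀`. If some artificial noise `u'` satisfies `‖U - τu'‖ ≤ ε`, the coefficients
`(β₀, στ)` give `Π₀` a residual of norm at most `σε`. For another admissible `Π`, `C_min > 0` keeps
`z` at distance `c > 0` from the range of `ΠX`. A residual that small could then arise only if `u'`
helped to approximate `z`, which is excluded when `U` has a component of length at least `ρ`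
orthogonal to the range of `ΠX` and `z`, with `ρ` large compared with `ε` (`sel_eq_of_close`).

Hence `Π₀` is missed only if a coordinate of `U` exceeds `R` (Gaussian tail), an orthogonal
component is shorter than `ρ` (small ball, order `ρ^(n-p-1)`), or no `U_ℓ` lies in the box of
half-width `h` around `U/R` (at most `exp(-(κh)^n L)`). With powers of `L` for `R`, `h`, `ρ`
(`exists_rate`), the small-ball term gives the exponent `(n-p-1)/(2(n-1))`. No logarithm is needed.

For coverage, `T` at the true parameters is exactly `F`-distributed, and the union over candidates
loses at most the probability that `Π₀` is missed. -/

/-! ### Gaussian vectors and orthogonal projections -/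

theorem measurable_sqNorm (n : ℕ) : Measurable (sqNorm : (Fin n → ℝ) → ℝ) := by
  unfold sqNorm
  fun_prop

theorem measurable_prodMk_sqNorm (a b : ℕ) :
    Measurable fun z : (Fin a → ℝ) × (Fin b → ℝ) => (sqNorm z.1, sqNorm z.2) :=
  ((measurable_sqNorm a).comp measurable_fst).prodMk ((measurable_sqNorm b).comp measurable_snd)

instance isProbabilityMeasure_stdNormal (n : ℕ) : IsProbabilityMeasure (stdNormal n) := by
  unfold stdNormal
  infer_instance

theorem sqNorm_eq_norm_sq {n : ℕ} (v : Fin n → ℝ) : sqNorm v = ‖WithLp.toLp 2 v‖ ^ 2 := by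
  simp [sqNorm, EuclideanSpace.real_norm_sq_eq]

theorem stdNormal_map_toLp (n : ℕ) :
    (stdNormal n).map (WithLp.toLp 2) = stdGaussian (EuclideanSpace ℝ (Fin n)) :=
  map_pi_eq_stdGaussian

theorem norm_sq_sum_smul_orthonormal {E ι : Type*} [NormedAddCommGroup E] [InnerProductSpace ℝ E]
    [Fintype ι] {v : ι → E} (hv : Orthonormal ℝ v) (x : ι → ℝ) :
    ‖∑ i, x i • v i‖ ^ 2 = ∑ i, x i ^ 2 := by
  rw [← real_inner_self_eq_norm_sq, hv.inner_sum]
  simp [sq]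

/-- The squared lengths of the projections of a standard Gaussian vector onto a subspace and onto
its orthogonal complement are independent, with chi-squared laws. -/
theorem stdGaussian_map_norm_sq_starProjection {E : Type*} [NormedAddCommGroup E]
    [InnerProductSpace ℝ E] [FiniteDimensional ℝ E] [MeasurableSpace E] [BorelSpace E]
    (V : Submodule ℝ E) {a b : ℕ} (ha : Module.finrank ℝ V = a) (hb : Module.finrank ℝ Vᗮ = b) :
    (stdGaussian E).map (fun x => (‖V.starProjection x‖ ^ 2, ‖Vᗮ.starProjection x‖ ^ 2)) =
      ((stdNormal a).prod (stdNormal b)).map (fun z => (sqNorm z.1, sqNorm z.2)) := by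
  subst ha hb
  -- In an orthonormal basis adapted to `V ⊕ Vᗮ` the Gaussian coordinates are i.i.d., and the two
  -- squared lengths use disjoint blocks of them.
  set B : OrthonormalBasis (Fin (Module.finrank ℝ V) ⊕ Fin (Module.finrank ℝ Vᗮ)) ℝ E :=
    ((stdOrthonormalBasis ℝ V).prod (stdOrthonormalBasis ℝ Vᗮ)).map
      V.orthogonalDecomposition.symm with hB
  have hl : ∀ i, B (Sum.inl i) = (stdOrthonormalBasis ℝ V i : E) := by
    intro i; simp [hB]
  have hr : ∀ i, B (Sum.inr i) = (stdOrthonormalBasis ℝ Vᗮ i : E) := by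
    intro i; simp [hB]
  have hsplit : ∀ x : Fin (Module.finrank ℝ V) ⊕ Fin (Module.finrank ℝ Vᗮ) → ℝ,
      ∑ i, x i • B i = ∑ i, x (Sum.inl i) • B (Sum.inl i) + ∑ i, x (Sum.inr i) • B (Sum.inr i) :=
    fun x => by rw [Fintype.sum_sum_type]
  have hmemV : ∀ x : Fin (Module.finrank ℝ V) ⊕ Fin (Module.finrank ℝ Vᗮ) → ℝ,
      ∑ i, x (Sum.inl i) • B (Sum.inl i) ∈ V := fun x =>
    V.sum_mem fun i _ => V.smul_mem _ (by rw [hl]; exact SetLike.coe_mem _)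
  have hmemW : ∀ x : Fin (Module.finrank ℝ V) ⊕ Fin (Module.finrank ℝ Vᗮ) → ℝ,
      ∑ i, x (Sum.inr i) • B (Sum.inr i) ∈ Vᗮ := fun x =>
    Vᗮ.sum_mem fun i _ => Vᗮ.smul_mem _ (by rw [hr]; exact SetLike.coe_mem _)
  have hPV : ∀ x : Fin (Module.finrank ℝ V) ⊕ Fin (Module.finrank ℝ Vᗮ) → ℝ,
      ‖V.starProjection (∑ i, x i • B i)‖ ^ 2 = ∑ i, x (Sum.inl i) ^ 2 := by
    intro x
    rw [hsplit, map_add, Submodule.starProjection_eq_self_iff.2 (hmemV x),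
      (Submodule.starProjection_apply_eq_zero_iff V).2 (hmemW x), add_zero]
    exact norm_sq_sum_smul_orthonormal
      (B.orthonormal.comp Sum.inl Sum.inl_injective) (fun i => x (Sum.inl i))
  have hPW : ∀ x : Fin (Module.finrank ℝ V) ⊕ Fin (Module.finrank ℝ Vᗮ) → ℝ,
      ‖Vᗮ.starProjection (∑ i, x i • B i)‖ ^ 2 = ∑ i, x (Sum.inr i) ^ 2 := by
    intro x
    rw [hsplit, map_add, Submodule.starProjection_eq_self_iff.2 (hmemW x),
      (Submodule.starProjection_apply_eq_zero_iff Vᗮ).2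
        (V.le_orthogonal_orthogonal (hmemV x)), zero_add]
    exact norm_sq_sum_smul_orthonormal
      (B.orthonormal.comp Sum.inr Sum.inr_injective) (fun i => x (Sum.inr i))
  have hmp := measurePreserving_sumPiEquivProdPi
    (fun _ : Fin (Module.finrank ℝ V) ⊕ Fin (Module.finrank ℝ Vᗮ) => gaussianReal 0 1)
  rw [stdGaussian_eq_map_pi_orthonormalBasis B, Measure.map_map (by fun_prop) (by fun_prop)]
  unfold stdNormal
  rw [← hmp.map_eq, Measure.map_map ?_ hmp.measurable]
  · congr 1
    funext x
    simp only [Function.comp_apply, hPV, hPW]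
    rfl
  · exact measurable_prodMk_sqNorm _ _

/-! ### Interval, tail and small-ball estimates -/

/-- With `1/2` in place of `1/√(2π)`, an interval of length `2r` has mass at most `r`, with no
constant. -/
theorem gaussianPDFReal_std_le_half (x : ℝ) : gaussianPDFReal 0 1 x ≤ 1 / 2 := by
  rw [gaussianPDFReal]
  have h1 : Real.exp (-(x - 0) ^ 2 / (2 * ((1 : NNReal) : ℝ))) ≤ 1 := by
    apply Real.exp_le_one_iff.2
    have := sq_nonneg (x - 0)
    simp only [NNReal.coe_one]
    linarith
  have h2 : (2 : ℝ) ≤ √(2 * Real.pi * ((1 : NNReal) : ℝ)) := by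
    apply Real.le_sqrt_of_sq_le
    have := Real.pi_gt_three
    simp only [NNReal.coe_one]
    linarith
  calc _ ≤ (2 : ℝ)⁻¹ * 1 := by
        apply mul_le_mul (inv_anti₀ (by norm_num) h2) h1 (Real.exp_pos _).le (by norm_num)
    _ = 1 / 2 := by norm_num

/-- The window `[-2, 2]` contains every `[a - h, a + h]` with `|a| ≤ 1` and `0 ≤ h ≤ 1`. -/
theorem exists_pos_le_gaussianPDFReal_std :
    ∃ κ : ℝ, 0 < κ ∧ ∀ x : ℝ, |x| ≤ 2 → κ ≤ gaussianPDFReal 0 1 x := by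
  refine ⟨gaussianPDFReal 0 1 2, gaussianPDFReal_pos _ _ _ one_ne_zero, fun x hx => ?_⟩
  rw [gaussianPDFReal, gaussianPDFReal]
  have : x ^ 2 ≤ 2 ^ 2 := by
    rw [← sq_abs]; gcongr
  have h : -(2 - 0) ^ 2 / (2 * ((1 : NNReal) : ℝ)) ≤ -(x - 0) ^ 2 / (2 * ((1 : NNReal) : ℝ)) := by
    simp only [NNReal.coe_one, sub_zero]
    linarith
  gcongr

theorem gaussianReal_std_real_Icc (a b : ℝ) :
    (gaussianReal 0 1).real (Set.Icc a b) = ∫ x in Set.Icc a b, gaussianPDFReal 0 1 x := by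
  rw [measureReal_def, gaussianReal_apply_eq_integral _ one_ne_zero,
    ENNReal.toReal_ofReal (integral_nonneg fun x => gaussianPDFReal_nonneg _ _ _)]

theorem gaussianReal_std_real_Icc_le {r : ℝ} (hr : 0 ≤ r) :
    (gaussianReal 0 1).real (Set.Icc (-r) r) ≤ r := by
  rw [gaussianReal_std_real_Icc]
  calc _ ≤ ∫ _ in Set.Icc (-r) r, (1 / 2 : ℝ) := by
        apply setIntegral_mono (integrable_gaussianPDFReal _ _).integrableOn
          (integrableOn_const (by simp))
        exact fun x => gaussianPDFReal_std_le_half x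
    _ = r := by
        rw [setIntegral_const, Real.volume_real_Icc_of_le (by linarith), smul_eq_mul]; ring

/-- Near the unit interval, the standard Gaussian measure of a short interval is bounded below by
a multiple of its length. -/
theorem exists_pos_mul_le_gaussianReal_std_real_Icc :
    ∃ κ : ℝ, 0 < κ ∧ ∀ a h : ℝ, |a| ≤ 1 → 0 ≤ h → h ≤ 1 →
      κ * h ≤ (gaussianReal 0 1).real (Set.Icc (a - h) (a + h)) := by
  obtain ⟨κ, hκ, hle⟩ := exists_pos_le_gaussianPDFReal_std
  refine ⟨2 * κ, by positivity, fun a h ha h0 h1 => ?_⟩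
  rw [gaussianReal_std_real_Icc]
  calc 2 * κ * h = ∫ _ in Set.Icc (a - h) (a + h), κ := by
        rw [setIntegral_const, Real.volume_real_Icc_of_le (by linarith), smul_eq_mul]; ring
    _ ≤ _ := by
        apply setIntegral_mono_on (integrableOn_const (by simp))
          (integrable_gaussianPDFReal _ _).integrableOn measurableSet_Icc
        intro x hx
        apply hle
        rw [abs_le] at ha ⊢
        constructor <;> linarith [hx.1, hx.2]

/-- Every polynomial tail bound holds for the standard Gaussian law. -/
theorem exists_gaussianReal_std_tail_le (N : ℕ) (hN : N ≠ 0) :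
    ∃ M : ℝ, 0 ≤ M ∧ ∀ r : ℝ, 0 < r →
      (gaussianReal 0 1).real {x | r < |x|} ≤ M * (r ^ N)⁻¹ := by
  have hint : Integrable (fun x : ℝ => |x| ^ N) (gaussianReal 0 1) := by
    have := (memLp_id_gaussianReal' (μ := 0) (v := 1) (N : ENNReal) (by simp)).integrable_norm_pow hN
    simpa using this
  refine ⟨∫ x, |x| ^ N ∂(gaussianReal 0 1), integral_nonneg fun x => by positivity,
    fun r hr => ?_⟩
  have h1 := mul_meas_ge_le_integral_of_nonneg (μ := gaussianReal 0 1)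
    (ae_of_all _ fun x : ℝ => by positivity) hint (r ^ N)
  have h2 : (gaussianReal 0 1).real {x | r < |x|} ≤
      (gaussianReal 0 1).real {x | r ^ N ≤ |x| ^ N} := by
    refine measureReal_mono fun x hx => ?_
    exact pow_le_pow_left₀ hr.le (le_of_lt hx) N
  have hpos : 0 < r ^ N := by positivity
  rw [← div_eq_mul_inv, le_div_iff₀ hpos, mul_comm]
  exact (mul_le_mul_of_nonneg_left h2 hpos.le).trans h1

/-- The ball lies in a cube of half-width `r`, whose mass is a product. -/
theorem stdNormal_real_sqNorm_lt_le {n : ℕ} {r : ℝ} (hr : 0 ≤ r) :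
    (stdNormal n).real {z | sqNorm z < r ^ 2} ≤ r ^ n := by
  have hsub : {z : Fin n → ℝ | sqNorm z < r ^ 2} ⊆ Set.univ.pi fun _ => Set.Icc (-r) r := by
    intro z hz i _
    have : z i ^ 2 ≤ r ^ 2 :=
      (Finset.single_le_sum (f := fun i => z i ^ 2) (fun j _ => sq_nonneg (z j))
        (Finset.mem_univ i)).trans (le_of_lt hz)
    exact abs_le.1 (abs_le_of_sq_le_sq this hr)
  calc _ ≤ (stdNormal n).real (Set.univ.pi fun _ => Set.Icc (-r) r) := measureReal_mono hsub
    _ = ∏ _ : Fin n, (gaussianReal 0 1).real (Set.Icc (-r) r) := by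
        rw [measureReal_def, stdNormal, Measure.pi_pi, ENNReal.toReal_prod]; rfl
    _ ≤ ∏ _ : Fin n, r := Finset.prod_le_prod (fun _ _ => measureReal_nonneg)
        fun _ _ => gaussianReal_std_real_Icc_le hr
    _ = r ^ n := by simp

/-- Small ball estimate for the projection of a standard Gaussian vector onto a subspace. -/
theorem stdGaussian_real_norm_starProjection_lt_le {E : Type*} [NormedAddCommGroup E]
    [InnerProductSpace ℝ E] [FiniteDimensional ℝ E] [MeasurableSpace E] [BorelSpace E]
    (W : Submodule ℝ E) {m : ℕ} (hm : m ≤ Module.finrank ℝ W) {r : ℝ} (hr : 0 ≤ r) :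
    (stdGaussian E).real {x | ‖W.starProjection x‖ < r} ≤ r ^ m := by
  -- Lowering the exponent from the dimension to `m` weakens the bound only for `r ≤ 1`; otherwise
  -- the bound is at least 1.
  rcases le_or_gt r 1 with h1 | h1
  · refine le_trans ?_ (pow_le_pow_of_le_one hr h1 hm)
    have h := stdGaussian_map_norm_sq_starProjection W rfl rfl
    have hs : MeasurableSet {q : ℝ × ℝ | q.1 < r ^ 2} :=
      measurableSet_lt measurable_fst measurable_const
    have e := congrArg (fun μ : Measure (ℝ × ℝ) => μ.real {q : ℝ × ℝ | q.1 < r ^ 2}) h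
    rw [map_measureReal_apply (by fun_prop) hs, map_measureReal_apply
      (measurable_prodMk_sqNorm _ _) hs] at e
    have e1 : {x : E | ‖W.starProjection x‖ < r} =
        (fun x => (‖W.starProjection x‖ ^ 2, ‖Wᗮ.starProjection x‖ ^ 2)) ⁻¹'
          {q : ℝ × ℝ | q.1 < r ^ 2} := by
      ext x
      simp only [Set.mem_ofPred_eq, Set.mem_preimage]
      exact (sq_lt_sq₀ (norm_nonneg _) hr).symm
    rw [e1, e]
    refine le_trans (le_of_eq ?_) (stdNormal_real_sqNorm_lt_le hr)
    have e2 : ((fun z : (Fin (Module.finrank ℝ W) → ℝ) × (Fin (Module.finrank ℝ Wᗮ) → ℝ) =>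
        (sqNorm z.1, sqNorm z.2)) ⁻¹' {q : ℝ × ℝ | q.1 < r ^ 2}) =
        {z | sqNorm z < r ^ 2} ×ˢ Set.univ := by
      ext z; simp
    rw [e2, measureReal_prod_prod]
    simp
  · exact measureReal_le_one.trans (one_le_pow₀ h1.le)

/-! ### Quantiles -/

theorem isProbabilityMeasure_fDist (a b : ℕ) : IsProbabilityMeasure (fDist a b) := by
  have hm := measurable_sqNorm
  apply Measure.isProbabilityMeasure_map
  exact ((((hm a).comp measurable_fst).div_const _).div
    (((hm b).comp measurable_snd).div_const _)).aemeasurable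

/-- Right-continuity of the distribution function carries the bound down to the infimum; `α < 1`
makes the set nonempty. -/
theorem le_real_Iic_quantile (μ : Measure ℝ) [IsProbabilityMeasure μ] {α : ℝ}
    (h1 : α < 1) : α ≤ μ.real (Set.Iic (quantile μ α)) := by
  set S : Set ℝ := {x | α ≤ μ.real (Set.Iic x)} with hS
  have hcdf : ∀ x, cdf μ x = μ.real (Set.Iic x) := cdf_eq_real μ
  have hne : S.Nonempty := by
    obtain ⟨x, hx⟩ := ((tendsto_cdf_atTop μ).eventually_const_lt h1).exists
    exact ⟨x, by rw [hS, Set.mem_ofPred_eq, ← hcdf]; exact hx.le⟩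
  have hq : quantile μ α = sInf S := rfl
  rw [hq, ← hcdf]
  have hgt : ∀ y, sInf S < y → α ≤ cdf μ y := by
    intro y hy
    obtain ⟨x, hxS, hxy⟩ := exists_lt_of_csInf_lt hne hy
    have hx : α ≤ cdf μ x := by rw [hcdf]; exact hxS
    exact hx.trans (monotone_cdf μ hxy.le)
  have ht : Tendsto (cdf μ) (nhdsWithin (sInf S) (Set.Ioi (sInf S))) (nhds (cdf μ (sInf S))) :=
    ((cdf μ).right_continuous (sInf S)).mono_left (nhdsWithin_mono _ Set.Ioi_subset_Ici_self)
  exact ge_of_tendsto ht (eventually_nhdsWithin_of_forall hgt)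

/-! ### Deterministic geometry of the residuals -/

/-- If `u` is close to a multiple of `u'`, and is bounded and not too close to the span of `V` and
`z`, then `z + σ u` stays away from the span of `V` and `u'`. -/
theorem lt_norm_add_smul_sub_sub_smul {E : Type*} [NormedAddCommGroup E] [InnerProductSpace ℝ E]
    [FiniteDimensional ℝ E] (V : Submodule ℝ E) {z u u' : E} {c σ ε ρ R τ : ℝ}
    (hc : ∀ w ∈ V, c ≤ ‖z - w‖) (hσ : 0 < σ) (hτ : τ ≠ 0) (hu : ‖u‖ ≤ R)
    (hclose : ‖u - τ • u'‖ ≤ ε) (hρ : 0 < ρ) (hρε : 2 * ε ≤ ρ)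
    (hproj : ρ ≤ ‖(V ⊔ ℝ ∙ z)ᗮ.starProjection u‖)
    (hsmall : 2 * σ * ε + 4 * σ * ε * (R + ε) / ρ < c) {w : E} (hw : w ∈ V) (s : ℝ) :
    σ * ε < ‖z + σ • u - w - s • u'‖ := by
  by_contra! hle
  set P := (V ⊔ ℝ ∙ z)ᗮ.starProjection with hP
  -- `t` is the excess of `s` over the ideal coefficient `στ`, in units of `τ`. Replacing `σu` by
  -- `στu'` costs `σε` and turns the residual into `q`. Since `P` kills `z` and `w`, it bounds
  -- `|t|`, and then `‖z - w‖` falls below `c`.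
  set t : ℝ := s / τ - σ with ht
  set q : E := z - w - t • τ • u' with hq
  have hε : 0 ≤ ε := (norm_nonneg _).trans hclose
  have hR : 0 ≤ R := (norm_nonneg _).trans hu
  have hqe : q = (z + σ • u - w - s • u') - σ • (u - τ • u') := by
    have : t * τ = s - σ * τ := by rw [ht]; field_simp
    rw [hq, smul_smul, this]
    module
  have hqn : ‖q‖ ≤ 2 * σ * ε := by
    rw [hqe]
    refine (norm_sub_le _ _).trans ?_
    rw [norm_smul, Real.norm_of_nonneg hσ.le]
    have := mul_le_mul_of_nonneg_left hclose hσ.le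
    linarith
  have hkill : ∀ x ∈ V ⊔ ℝ ∙ z, P x = 0 := fun x hx =>
    (Submodule.starProjection_apply_eq_zero_iff _).2 (Submodule.le_orthogonal_orthogonal _ hx)
  have hPz : P z = 0 :=
    hkill z (Submodule.mem_sup_right (Submodule.mem_span_singleton_self z))
  have hPw : P w = 0 := hkill w (Submodule.mem_sup_left hw)
  have hPle : ∀ x, ‖P x‖ ≤ ‖x‖ := fun x => Submodule.norm_starProjection_apply_le _ x
  have hPu' : ρ / 2 ≤ ‖P (τ • u')‖ := by
    have h1 : ‖P u‖ ≤ ‖P (u - τ • u')‖ + ‖P (τ • u')‖ := by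
      refine le_trans (le_of_eq ?_) (norm_add_le _ _)
      rw [← map_add, sub_add_cancel]
    have := (hPle (u - τ • u')).trans hclose
    linarith
  have hPq : |t| * ‖P (τ • u')‖ ≤ 2 * σ * ε := by
    have h1 : P q = -(t • P (τ • u')) := by
      rw [hq, map_sub, map_sub, hPz, hPw, map_smul]
      simp
    have h2 := (hPle q).trans hqn
    rwa [h1, norm_neg, norm_smul, Real.norm_eq_abs] at h2
  have htle : |t| ≤ 4 * σ * ε / ρ := by
    rw [le_div_iff₀ hρ]
    have := mul_le_mul_of_nonneg_left hPu' (abs_nonneg t)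
    linarith
  have hu'n : ‖τ • u'‖ ≤ R + ε := by
    have : τ • u' = u - (u - τ • u') := by abel
    rw [this]
    exact (norm_sub_le _ _).trans (add_le_add hu hclose)
  have hzw : ‖z - w‖ ≤ 2 * σ * ε + 4 * σ * ε / ρ * (R + ε) := by
    have : z - w = q + t • τ • u' := by rw [hq]; abel
    rw [this]
    refine (norm_add_le _ _).trans (add_le_add hqn ?_)
    rw [norm_smul, Real.norm_eq_abs]
    exact mul_le_mul htle hu'n (norm_nonneg _) (by positivity)
  have := hc w hw
  have e : 4 * σ * ε * (R + ε) / ρ = 4 * σ * ε / ρ * (R + ε) := by ring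
  linarith

section projections

variable {n : ℕ} {ι : Type} [Fintype ι] [DecidableEq ι]

theorem toLp_projMatrix_mulVec (A : Matrix (Fin n) ι ℝ) (v : Fin n → ℝ) :
    WithLp.toLp 2 ((projMatrix A).mulVec v) =
      (LinearMap.range (Matrix.toEuclideanLin A)).starProjection (WithLp.toLp 2 v) := by
  exact congrArg (fun f : EuclideanSpace ℝ (Fin n) →ₗ[ℝ] EuclideanSpace ℝ (Fin n) =>
    f (WithLp.toLp 2 v)) (LinearEquiv.apply_symm_apply Matrix.toEuclideanLin _)

theorem toLp_one_sub_projMatrix_mulVec (A : Matrix (Fin n) ι ℝ) (v : Fin n → ℝ) :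
    WithLp.toLp 2 ((1 - projMatrix A).mulVec v) =
      (LinearMap.range (Matrix.toEuclideanLin A))ᗮ.starProjection (WithLp.toLp 2 v) := by
  rw [Matrix.sub_mulVec, Matrix.one_mulVec, WithLp.toLp_sub, toLp_projMatrix_mulVec,
    Submodule.starProjection_orthogonal_val]

theorem mulVec_projMatrix_mulVec (A : Matrix (Fin n) ι ℝ) (c : ι → ℝ) :
    (projMatrix A).mulVec (A.mulVec c) = A.mulVec c := by
  have h : WithLp.toLp 2 ((projMatrix A).mulVec (A.mulVec c)) = WithLp.toLp 2 (A.mulVec c) := by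
    rw [toLp_projMatrix_mulVec, Submodule.starProjection_eq_self_iff]
    exact ⟨WithLp.toLp 2 c, Matrix.toLpLin_toLp ..⟩
  exact WithLp.toLp_injective 2 h

/-- With the next lemma, this turns the projection objective into an attained minimum over
coefficients, so rank deficiency of `A` plays no role. -/
theorem sqNorm_one_sub_projMatrix_mulVec_le (A : Matrix (Fin n) ι ℝ) (y : Fin n → ℝ)
    (c : ι → ℝ) :
    sqNorm ((1 - projMatrix A).mulVec y) ≤ sqNorm (y - A.mulVec c) := by
  have h : (1 - projMatrix A).mulVec y = (1 - projMatrix A).mulVec (y - A.mulVec c) := by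
    rw [Matrix.mulVec_sub, Matrix.sub_mulVec _ _ (A.mulVec c), mulVec_projMatrix_mulVec]
    simp
  rw [h, sqNorm_eq_norm_sq, sqNorm_eq_norm_sq, toLp_one_sub_projMatrix_mulVec]
  gcongr
  exact Submodule.norm_starProjection_apply_le _ _

theorem exists_sqNorm_one_sub_projMatrix_mulVec_eq (A : Matrix (Fin n) ι ℝ) (y : Fin n → ℝ) :
    ∃ c : ι → ℝ, sqNorm ((1 - projMatrix A).mulVec y) = sqNorm (y - A.mulVec c) := by
  have hmem : WithLp.toLp 2 ((projMatrix A).mulVec y) ∈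
      LinearMap.range (Matrix.toEuclideanLin A) := by
    rw [toLp_projMatrix_mulVec]; exact Submodule.starProjection_apply_mem _ _
  obtain ⟨c, hc⟩ := hmem
  refine ⟨WithLp.ofLp c, ?_⟩
  have h : A.mulVec (WithLp.ofLp c) = (projMatrix A).mulVec y := by
    apply WithLp.toLp_injective 2
    rw [← hc]
    rfl
  rw [Matrix.sub_mulVec, Matrix.one_mulVec, h]

end projections

/-! ### Separation and selection of the true permutation -/

theorem augDesign_mulVec {n p : ℕ} (π : Equiv.Perm (Fin n)) (X : Matrix (Fin n) (Fin p) ℝ)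
    (u : Fin n → ℝ) (c : Fin p ⊕ Unit → ℝ) :
    (augDesign π X u).mulVec c =
      (permDesign π X).mulVec (c ∘ Sum.inl) + c (Sum.inr ()) • u := by
  rw [augDesign, Matrix.fromCols_mulVec]
  congr 1
  ext i
  simp [Matrix.mulVec, dotProduct, mul_comm]

/-- `Π M_X Πᵀ` fixes every vector `ΠXb`, because `ΠᵀΠ = 1`. -/
theorem ne_permDesign_mulVec_of_residual_pos {n p : ℕ} {X : Matrix (Fin n) (Fin p) ℝ}
    {π : Equiv.Perm (Fin n)} {z : Fin n → ℝ}
    (h : 0 < sqNorm ((1 - π.permMatrix ℝ * projMatrix X *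
      (π.permMatrix ℝ).transpose).mulVec z)) (b : Fin p → ℝ) :
    z ≠ (permDesign π X).mulVec b := by
  rintro rfl
  have h1 : (π.permMatrix ℝ).transpose * π.permMatrix ℝ = 1 := by
    rw [Matrix.transpose_permMatrix, ← Matrix.permMatrix_mul]
    simp
  have h2 : (π.permMatrix ℝ * projMatrix X * (π.permMatrix ℝ).transpose).mulVec
      ((permDesign π X).mulVec b) = (permDesign π X).mulVec b := by
    rw [permDesign, ← Matrix.mulVec_mulVec b, ← Matrix.mulVec_mulVec,
      Matrix.mulVec_mulVec (X.mulVec b), h1, Matrix.one_mulVec, ← Matrix.mulVec_mulVec,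
      mulVec_projMatrix_mulVec]
  rw [Matrix.sub_mulVec, h2] at h
  simp [sqNorm] at h

/-- The separation constant is positive only if `Π₀ X β₀` is at positive distance from the range
of every other admissible design. -/
theorem exists_pos_le_norm_sub_of_Cmin_pos {n p k : ℕ}
    {X : Matrix (Fin n) (Fin p) ℝ} {π₀ : Equiv.Perm (Fin n)} {β₀ : Fin p → ℝ}
    (hC : 0 < Cmin X k π₀ β₀) :
    ∃ c : ℝ, 0 < c ∧ ∀ π ∈ sparsePerms n k \ {π₀},
      ∀ w ∈ LinearMap.range (Matrix.toEuclideanLin (permDesign π X)),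
        c ≤ ‖WithLp.toLp 2 ((permDesign π₀ X).mulVec β₀) - w‖ := by
  set z := (permDesign π₀ X).mulVec β₀ with hz
  have hpos : ∀ π ∈ sparsePerms n k \ {π₀}, 0 < sqNorm ((1 - projMatrix (permDesign π X)).mulVec z) := by
    intro π hπ
    obtain ⟨b, hb⟩ := exists_sqNorm_one_sub_projMatrix_mulVec_eq (permDesign π X) z
    have hlt := hC.trans_le (iInf₂_le π hπ)
    rw [← EReal.coe_zero, EReal.coe_lt_coe_iff] at hlt
    have hden : 0 ≤ (n : ℝ) * max ((mismatches π₀ : ℝ) - (mismatches π : ℝ)) 1 :=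
      mul_nonneg (Nat.cast_nonneg _) (zero_le_one.trans (le_max_right _ _))
    -- A zero denominator would make the quotient `0` by convention, against `hlt`.
    have hnum := (div_pos_iff_of_pos_right (lt_of_le_of_ne hden fun h => by
      rw [← h, div_zero] at hlt; exact lt_irrefl _ hlt)).1 hlt
    have hne := ne_permDesign_mulVec_of_residual_pos hnum b
    rw [hb, sqNorm_eq_norm_sq]
    have : WithLp.toLp 2 (z - (permDesign π X).mulVec b) ≠ 0 := by
      rw [Ne, WithLp.toLp_eq_zero, sub_eq_zero]
      exact hne
    positivity
  have key : ∀ π ∈ sparsePerms n k \ {π₀},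
      ∀ w ∈ LinearMap.range (Matrix.toEuclideanLin (permDesign π X)),
        √(sqNorm ((1 - projMatrix (permDesign π X)).mulVec z)) ≤ ‖WithLp.toLp 2 z - w‖ := by
    rintro π - _ ⟨b, rfl⟩
    apply Real.sqrt_le_iff.2 ⟨norm_nonneg _, ?_⟩
    refine (sqNorm_one_sub_projMatrix_mulVec_le _ z (WithLp.ofLp b)).trans (le_of_eq ?_)
    rw [sqNorm_eq_norm_sq]
    rfl
  have hfin : (sparsePerms n k \ {π₀}).Finite := Set.toFinite _
  -- Without competitors any constant works; otherwise the finite set of positive distances has a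
  -- positive minimum.
  rcases (sparsePerms n k \ {π₀}).eq_empty_or_nonempty with he | hne
  · exact ⟨1, one_pos, by simp [he]⟩
  · obtain ⟨π₁, h1, hmin⟩ := Set.exists_min_image _
      (fun π => √(sqNorm ((1 - projMatrix (permDesign π X)).mulVec z))) hfin hne
    exact ⟨_, Real.sqrt_pos.2 (hpos π₁ h1), fun π hπ w hw => (hmin π hπ).trans (key π hπ w hw)⟩

/-- The orthogonal complement of the span of the range of `Π X` and of `z`. -/
def nuisanceComplement {n p : ℕ} (X : Matrix (Fin n) (Fin p) ℝ) (z : Fin n → ℝ)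
    (π : Equiv.Perm (Fin n)) : Submodule ℝ (EuclideanSpace ℝ (Fin n)) :=
  (LinearMap.range (Matrix.toEuclideanLin (permDesign π X)) ⊔ ℝ ∙ WithLp.toLp 2 z)ᗮ

/-- The range has dimension at most `p` and `z` adds at most one. This is the exponent of the
small-ball bound. -/
theorem le_finrank_nuisanceComplement {n p : ℕ} (X : Matrix (Fin n) (Fin p) ℝ) (z : Fin n → ℝ)
    (π : Equiv.Perm (Fin n)) : n - p - 1 ≤ Module.finrank ℝ (nuisanceComplement X z π) := by
  have h1 := Submodule.finrank_add_finrank_orthogonal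
    (LinearMap.range (Matrix.toEuclideanLin (permDesign π X)) ⊔ ℝ ∙ WithLp.toLp 2 z)
  have h2 := Submodule.finrank_add_le_finrank_add_finrank
    (LinearMap.range (Matrix.toEuclideanLin (permDesign π X)))
    (ℝ ∙ (WithLp.toLp 2 z : EuclideanSpace ℝ (Fin n)))
  have h3 := finrank_span_le_card (R := ℝ) ({WithLp.toLp 2 z} : Set (EuclideanSpace ℝ (Fin n)))
  rw [Set.toFinset_singleton, Finset.card_singleton] at h3
  have h4 := LinearMap.finrank_range_le (Matrix.toEuclideanLin (permDesign π X))
  rw [finrank_euclideanSpace_fin] at h1 h4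
  rw [nuisanceComplement]
  omega

/-- The true permutation is selected as soon as the artificial noise is nearly proportional to the
noise of the observation, and the latter is in general position. -/
theorem sel_eq_of_close {n p k : ℕ} {X : Matrix (Fin n) (Fin p) ℝ} {π₀ : Equiv.Perm (Fin n)}
    (hπ₀ : π₀ ∈ sparsePerms n k) {β₀ : Fin p → ℝ} {c σ ε ρ R τ : ℝ}
    (hc : ∀ π ∈ sparsePerms n k \ {π₀},
      ∀ w ∈ LinearMap.range (Matrix.toEuclideanLin (permDesign π X)),
        c ≤ ‖WithLp.toLp 2 ((permDesign π₀ X).mulVec β₀) - w‖)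
    (hσ : 0 < σ) (hτ : τ ≠ 0) {u u' : Fin n → ℝ} (hu : ‖WithLp.toLp 2 u‖ ≤ R)
    (hclose : ‖WithLp.toLp 2 (u - τ • u')‖ ≤ ε) (hρ : 0 < ρ) (hρε : 2 * ε ≤ ρ)
    (hproj : ∀ π ∈ sparsePerms n k \ {π₀}, ρ ≤
      ‖(nuisanceComplement X ((permDesign π₀ X).mulVec β₀) π).starProjection (WithLp.toLp 2 u)‖)
    (hsmall : 2 * σ * ε + 4 * σ * ε * (R + ε) / ρ < c)
    {sel : (Fin n → ℝ) → (Fin n → ℝ) → Equiv.Perm (Fin n)} (hsel : IsArgminRule X k sel) :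
    sel (response X π₀ β₀ σ u) u' = π₀ := by
  by_contra hne
  set y := response X π₀ β₀ σ u with hy
  obtain ⟨hmem, hmin⟩ := hsel y u'
  set π := sel y u' with hπ
  have hπG : π ∈ sparsePerms n k \ {π₀} := ⟨hmem, hne⟩
  have hε : 0 ≤ ε := (norm_nonneg _).trans hclose
  -- With coefficients `(β₀, στ)` the residual is exactly `σ(u - τu')`.
  have h0 : objective X y u' π₀ ≤ (σ * ε) ^ 2 := by
    refine (sqNorm_one_sub_projMatrix_mulVec_le _ y
      (Sum.elim β₀ fun _ => σ * τ)).trans ?_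
    rw [augDesign_mulVec, sqNorm_eq_norm_sq]
    have : y - ((permDesign π₀ X).mulVec (Sum.elim β₀ (fun _ : Unit => σ * τ) ∘ Sum.inl) +
        (Sum.elim β₀ fun _ : Unit => σ * τ) (Sum.inr ()) • u') = σ • (u - τ • u') := by
      rw [hy, response, Sum.elim_comp_inl, Sum.elim_inr]
      module
    rw [this, WithLp.toLp_smul, norm_smul, Real.norm_of_nonneg hσ.le]
    gcongr
  obtain ⟨b, hb⟩ := exists_sqNorm_one_sub_projMatrix_mulVec_eq (augDesign π X u') y
  have h1 : (σ * ε) ^ 2 < objective X y u' π := by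
    rw [objective, hb, augDesign_mulVec, sqNorm_eq_norm_sq]
    have h := lt_norm_add_smul_sub_sub_smul
      (LinearMap.range (Matrix.toEuclideanLin (permDesign π X))) (hc π hπG) hσ hτ hu
      (u' := WithLp.toLp 2 u') hclose hρ hρε (hproj π hπG) hsmall
      (w := WithLp.toLp 2 ((permDesign π X).mulVec (b ∘ Sum.inl)))
      ⟨WithLp.toLp 2 (b ∘ Sum.inl), Matrix.toLpLin_toLp ..⟩ (b (Sum.inr ()))
    have e : WithLp.toLp 2 (y - ((permDesign π X).mulVec (b ∘ Sum.inl) + b (Sum.inr ()) • u')) =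
        WithLp.toLp 2 ((permDesign π₀ X).mulVec β₀) + σ • WithLp.toLp 2 u -
          WithLp.toLp 2 ((permDesign π X).mulVec (b ∘ Sum.inl)) -
          b (Sum.inr ()) • WithLp.toLp 2 u' := by
      rw [hy, response, ← sub_sub]
      rfl
    rw [e]
    exact pow_lt_pow_left₀ h (by positivity) two_ne_zero
  exact absurd (hmin hπ₀) (not_le.2 (h0.trans_lt h1))

/-! ### Probability of missing the true permutation -/

instance isProbabilityMeasure_jointLaw (n L : ℕ) : IsProbabilityMeasure (jointLaw n L) := by
  unfold jointLaw
  infer_instance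

theorem jointLaw_real_preimage_snd {n L : ℕ} (A : Set (Fin n → ℝ)) :
    (jointLaw n L).real {w | w.2 ∈ A} = (stdNormal n).real A := by
  have : {w : (Fin L → Fin n → ℝ) × (Fin n → ℝ) | w.2 ∈ A} = Set.univ ×ˢ A := by
    ext w; simp
  rw [this, jointLaw, measureReal_prod_prod]
  simp

theorem norm_toLp_le_of_abs_le {n : ℕ} {x : Fin n → ℝ} {B : ℝ} (hx : ∀ i, |x i| ≤ B)
    (hB : 0 ≤ B) : ‖WithLp.toLp 2 x‖ ≤ n * B := by
  refine le_trans (le_abs_self _) (abs_le_of_sq_le_sq ?_ (by positivity))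
  rw [← sqNorm_eq_norm_sq, sqNorm]
  calc ∑ i, x i ^ 2 ≤ ∑ _ : Fin n, B ^ 2 := Finset.sum_le_sum fun i _ => by
        rw [← sq_abs]; exact pow_le_pow_left₀ (abs_nonneg _) (hx i) 2
    _ = n * B ^ 2 := by simp
    _ ≤ n ^ 2 * B ^ 2 := by
        have : (n : ℝ) ≤ (n : ℝ) ^ 2 := by exact_mod_cast Nat.le_self_pow two_ne_zero n
        gcongr
    _ = (n * B) ^ 2 := by ring

theorem stdNormal_real_exists_lt_abs_le {n : ℕ} (R : ℝ) :
    (stdNormal n).real {u | ∃ i, R < |u i|} ≤ n * (gaussianReal 0 1).real {x | R < |x|} := by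
  have hs : MeasurableSet {x : ℝ | R < |x|} := measurableSet_lt measurable_const measurable_abs
  have h : {u : Fin n → ℝ | ∃ i, R < |u i|} = ⋃ i, (fun u => u i) ⁻¹' {x | R < |x|} := by
    ext u; simp
  rw [h]
  refine (measureReal_iUnion_fintype_le _).trans (le_of_eq ?_)
  have : ∀ i : Fin n, (stdNormal n).real ((fun u : Fin n → ℝ => u i) ⁻¹' {x | R < |x|}) =
      (gaussianReal 0 1).real {x | R < |x|} := fun i =>
    (measurePreserving_eval (fun _ : Fin n => gaussianReal 0 1) i).measureReal_preimage
      hs.nullMeasurableSet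
  rw [Finset.sum_congr rfl fun i _ => this i]
  simp

/-- A standard Gaussian vector is close to a given vector of the unit cube with probability at
least the volume of the neighbourhood, up to a constant. -/
theorem pow_le_stdNormal_real_pi_Icc {n : ℕ} {κ h : ℝ} (hκ : 0 < κ)
    (hle : ∀ a h : ℝ, |a| ≤ 1 → 0 ≤ h → h ≤ 1 →
      κ * h ≤ (gaussianReal 0 1).real (Set.Icc (a - h) (a + h)))
    (h0 : 0 ≤ h) (h1 : h ≤ 1) {a : Fin n → ℝ} (ha : ∀ i, |a i| ≤ 1) :
    (κ * h) ^ n ≤ (stdNormal n).real (Set.univ.pi fun i => Set.Icc (a i - h) (a i + h)) := by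
  calc (κ * h) ^ n = ∏ _ : Fin n, (κ * h) := by simp
    _ ≤ ∏ i : Fin n, (gaussianReal 0 1).real (Set.Icc (a i - h) (a i + h)) :=
        Finset.prod_le_prod (fun _ _ => by positivity) fun i _ => hle _ _ (ha i) h0 h1
    _ = _ := by
        rw [measureReal_def, stdNormal, Measure.pi_pi, ENNReal.toReal_prod]; rfl

/-- By independence the mass is at most `(1 - q)^L ≤ exp(-qL)`. -/
theorem pi_stdNormal_forall_notMem_le {n L : ℕ} {A : Set (Fin n → ℝ)} (hA : MeasurableSet A)
    {q : ℝ} (hq : q ≤ (stdNormal n).real A) :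
    (Measure.pi fun _ : Fin L => stdNormal n) {us | ∀ l, us l ∉ A} ≤
      ENNReal.ofReal (Real.exp (-(q * L))) := by
  have h : {us : Fin L → Fin n → ℝ | ∀ l, us l ∉ A} = Set.univ.pi fun _ => Aᶜ := by
    ext us; simp
  have h2 : (stdNormal n) Aᶜ ≤ ENNReal.ofReal (Real.exp (-q)) := by
    rw [← ofReal_measureReal]
    apply ENNReal.ofReal_le_ofReal
    rw [probReal_compl_eq_one_sub hA]
    linarith [Real.one_sub_le_exp_neg q]
  rw [h, Measure.pi_pi, Finset.prod_const, Finset.card_univ, Fintype.card_fin]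
  calc _ ≤ ENNReal.ofReal (Real.exp (-q)) ^ L := by gcongr
    _ = _ := by
      rw [← ENNReal.ofReal_pow (Real.exp_pos _).le, ← Real.exp_nat_mul]
      congr 2
      ring

/-- Condition on `U = u`. The cutoff `|u i| ≤ R` puts `u/R` in the unit cube, where the box mass has
a uniform lower bound; fibres beyond the cutoff are empty. -/
theorem jointLaw_real_not_close_le {n L : ℕ} {κ h R : ℝ} (hκ : 0 < κ)
    (hle : ∀ a h : ℝ, |a| ≤ 1 → 0 ≤ h → h ≤ 1 →
      κ * h ≤ (gaussianReal 0 1).real (Set.Icc (a - h) (a + h)))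
    (h0 : 0 ≤ h) (h1 : h ≤ 1) (hR : 0 < R) :
    (jointLaw n L).real {w | (∀ i, |w.2 i| ≤ R) ∧
      ∀ l, w.1 l ∉ Set.univ.pi fun i => Set.Icc (w.2 i / R - h) (w.2 i / R + h)} ≤
      Real.exp (-((κ * h) ^ n * L)) := by
  have hm1 : MeasurableSet {w : (Fin L → Fin n → ℝ) × (Fin n → ℝ) | ∀ i, |w.2 i| ≤ R} := by
    rw [Set.ofPred_forall]
    exact MeasurableSet.iInter fun i => measurableSet_le (by fun_prop) (by fun_prop)
  have hm2 : MeasurableSet {w : (Fin L → Fin n → ℝ) × (Fin n → ℝ) | ∀ l, w.1 l ∉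
      Set.univ.pi fun i => Set.Icc (w.2 i / R - h) (w.2 i / R + h)} := by
    rw [Set.ofPred_forall]
    refine MeasurableSet.iInter fun l => ?_
    have hbox : MeasurableSet (⋂ i, ({w : (Fin L → Fin n → ℝ) × (Fin n → ℝ) |
        w.2 i / R - h ≤ w.1 l i} ∩ {w | w.1 l i ≤ w.2 i / R + h})) :=
      MeasurableSet.iInter fun i => (measurableSet_le (by fun_prop) (by fun_prop)).inter
        (measurableSet_le (by fun_prop) (by fun_prop))
    convert hbox.compl using 1
    ext w
    simp only [Set.mem_compl_iff, Set.mem_iInter, Set.mem_inter_iff, Set.mem_ofPred_eq,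
      Set.mem_pi, Set.mem_univ, true_imp_iff, Set.mem_Icc]
  have hm := hm1.inter hm2
  apply ENNReal.toReal_le_of_le_ofReal (Real.exp_pos _).le
  rw [jointLaw]
  refine (Measure.prod_apply_symm hm).le.trans ?_
  have hb : ∀ u : Fin n → ℝ, (Measure.pi fun _ : Fin L => stdNormal n)
      ((fun us => (us, u)) ⁻¹' ({w : (Fin L → Fin n → ℝ) × (Fin n → ℝ) | ∀ i, |w.2 i| ≤ R} ∩
        {w | ∀ l, w.1 l ∉ Set.univ.pi fun i => Set.Icc (w.2 i / R - h) (w.2 i / R + h)})) ≤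
      ENNReal.ofReal (Real.exp (-((κ * h) ^ n * L))) := by
    intro u
    by_cases hu : ∀ i, |u i| ≤ R
    · refine le_trans (measure_mono fun us hus => hus.2) (pi_stdNormal_forall_notMem_le
        (A := Set.univ.pi fun i => Set.Icc (u i / R - h) (u i / R + h))
        (MeasurableSet.univ_pi fun i => measurableSet_Icc)
        (pow_le_stdNormal_real_pi_Icc hκ hle h0 h1 fun i => ?_))
      rw [abs_div, abs_of_pos hR, div_le_one hR]
      exact hu i
    · refine le_trans (le_of_eq ?_) zero_le
      convert measure_empty (μ := Measure.pi fun _ : Fin L => stdNormal n)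
      ext us
      simp only [Set.mem_preimage, Set.mem_inter_iff, Set.mem_ofPred_eq, Set.mem_empty_iff_false,
        iff_false, not_and]
      exact fun h => absurd h hu
  refine (lintegral_mono hb).trans ?_
  simp

/-- Nonasymptotic bound for the probability that the candidate set misses the true permutation. -/
theorem jointLaw_real_notMem_candidateSet_le {n p k L : ℕ} {X : Matrix (Fin n) (Fin p) ℝ}
    {π₀ : Equiv.Perm (Fin n)} (hπ₀ : π₀ ∈ sparsePerms n k) {β₀ : Fin p → ℝ} {c σ ρ R κ h : ℝ}
    (hc : ∀ π ∈ sparsePerms n k \ {π₀},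
      ∀ w ∈ LinearMap.range (Matrix.toEuclideanLin (permDesign π X)),
        c ≤ ‖WithLp.toLp 2 ((permDesign π₀ X).mulVec β₀) - w‖)
    (hσ : 0 < σ) (hκ : 0 < κ)
    (hle : ∀ a h : ℝ, |a| ≤ 1 → 0 ≤ h → h ≤ 1 →
      κ * h ≤ (gaussianReal 0 1).real (Set.Icc (a - h) (a + h)))
    (h0 : 0 ≤ h) (h1 : h ≤ 1) (hR : 0 < R) (hρ : 0 < ρ) (hρε : 2 * (n * (R * h)) ≤ ρ)
    (hsmall : 2 * σ * (n * (R * h)) + 4 * σ * (n * (R * h)) * (n * R + n * (R * h)) / ρ < c)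
    {sel : (Fin n → ℝ) → (Fin n → ℝ) → Equiv.Perm (Fin n)} (hsel : IsArgminRule X k sel) :
    (jointLaw n L).real {w | π₀ ∉ candidateSet sel (response X π₀ β₀ σ w.2) w.1} ≤
      n * (gaussianReal 0 1).real {x | R < |x|} +
        Fintype.card (Equiv.Perm (Fin n)) * ρ ^ (n - p - 1) +
        Real.exp (-((κ * h) ^ n * L)) := by
  set W := nuisanceComplement X ((permDesign π₀ X).mulVec β₀) with hW
  set B₁ : Set (Fin n → ℝ) := {u | ∃ i, R < |u i|} with hB₁
  set B₂ : Set (Fin n → ℝ) := ⋃ π, {u | ‖(W π).starProjection (WithLp.toLp 2 u)‖ < ρ} with hB₂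
  set B₃ : Set ((Fin L → Fin n → ℝ) × (Fin n → ℝ)) := {w | (∀ i, |w.2 i| ≤ R) ∧
      ∀ l, w.1 l ∉ Set.univ.pi fun i => Set.Icc (w.2 i / R - h) (w.2 i / R + h)} with hB₃
  -- The selection rule is arbitrary, so the failure event need not be measurable; monotonicity and
  -- subadditivity of the outer measure suffice. Taking `B₂` over all permutations produces the
  -- factor `n!`.
  have hsub : {w : (Fin L → Fin n → ℝ) × (Fin n → ℝ) |
      π₀ ∉ candidateSet sel (response X π₀ β₀ σ w.2) w.1} ⊆
      {w | w.2 ∈ B₁} ∪ {w | w.2 ∈ B₂} ∪ B₃ := by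
    intro w hw
    by_contra hnot
    simp only [Set.mem_union, not_or] at hnot
    obtain ⟨⟨hn1, hn2⟩, hn3⟩ := hnot
    have hn1 : ∀ i, |w.2 i| ≤ R := by
      intro i
      by_contra! hlt
      exact hn1 ⟨i, hlt⟩
    have hn2 : ∀ π, ρ ≤ ‖(W π).starProjection (WithLp.toLp 2 w.2)‖ := by
      intro π
      by_contra! hlt
      exact hn2 (Set.mem_iUnion.2 ⟨π, hlt⟩)
    have hn3 : ∃ l, w.1 l ∈ Set.univ.pi fun i => Set.Icc (w.2 i / R - h) (w.2 i / R + h) := by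
      by_contra! hall
      exact hn3 ⟨hn1, hall⟩
    obtain ⟨l, hl⟩ := hn3
    -- Here `τ = R`: coordinates of `u/R - u'` of size at most `h` give `‖u - R u'‖ ≤ nRh`, the
    -- value of `ε`.
    refine hw ⟨l, sel_eq_of_close hπ₀ hc hσ hR.ne' (norm_toLp_le_of_abs_le hn1 hR.le)
      (norm_toLp_le_of_abs_le (fun i => ?_) (by positivity)) hρ hρε (fun π _ => hn2 π) hsmall hsel⟩
    have hi := hl i (Set.mem_univ i)
    have e : (w.2 - R • w.1 l) i = R * (w.2 i / R - w.1 l i) := by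
      simp only [Pi.sub_apply, Pi.smul_apply, smul_eq_mul]
      field_simp
    rw [e, abs_mul, abs_of_pos hR]
    refine mul_le_mul_of_nonneg_left (abs_le.2 ⟨?_, ?_⟩) hR.le <;> linarith [hi.1, hi.2]
  have b2 : (stdNormal n).real B₂ ≤ Fintype.card (Equiv.Perm (Fin n)) * ρ ^ (n - p - 1) := by
    refine (measureReal_iUnion_fintype_le _).trans ?_
    rw [← nsmul_eq_mul]
    refine Finset.sum_le_card_nsmul _ _ _ fun π _ => ?_
    have := stdGaussian_real_norm_starProjection_lt_le (W π)
      (le_finrank_nuisanceComplement X ((permDesign π₀ X).mulVec β₀) π) hρ.le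
    rwa [← stdNormal_map_toLp, map_measureReal_apply (by fun_prop)
      (measurableSet_lt (by fun_prop) (by fun_prop))] at this
  calc _ ≤ (jointLaw n L).real ({w | w.2 ∈ B₁} ∪ {w | w.2 ∈ B₂} ∪ B₃) := measureReal_mono hsub
    _ ≤ (jointLaw n L).real {w | w.2 ∈ B₁} + (jointLaw n L).real {w | w.2 ∈ B₂} +
        (jointLaw n L).real B₃ :=
      (measureReal_union_le _ _).trans (add_le_add_left (measureReal_union_le _ _) _)
    _ ≤ _ := by
      rw [jointLaw_real_preimage_snd, jointLaw_real_preimage_snd]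
      exact add_le_add (add_le_add (stdNormal_real_exists_lt_abs_le R) b2)
        (jointLaw_real_not_close_le hκ hle h0 h1 hR)

/-! ### Exact law of the statistic and coverage -/

theorem dotProduct_projMatrix_mulVec {n : ℕ} {ι : Type} [Fintype ι] [DecidableEq ι]
    (A : Matrix (Fin n) ι ℝ) (v : Fin n → ℝ) :
    v ⬝ᵥ (projMatrix A).mulVec v =
      ‖(LinearMap.range (Matrix.toEuclideanLin A)).starProjection (WithLp.toLp 2 v)‖ ^ 2 := by
  have h := Submodule.re_inner_starProjection_eq_normSq
    (LinearMap.range (Matrix.toEuclideanLin A)) (WithLp.toLp 2 v)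
  rw [← toLp_projMatrix_mulVec, EuclideanSpace.inner_toLp_toLp] at h
  simpa using h

theorem dotProduct_one_sub_projMatrix_mulVec {n : ℕ} {ι : Type} [Fintype ι] [DecidableEq ι]
    (A : Matrix (Fin n) ι ℝ) (v : Fin n → ℝ) :
    v ⬝ᵥ (1 - projMatrix A).mulVec v =
      ‖(LinearMap.range (Matrix.toEuclideanLin A))ᗮ.starProjection (WithLp.toLp 2 v)‖ ^ 2 := by
  have h := Submodule.re_inner_starProjection_eq_normSq
    (LinearMap.range (Matrix.toEuclideanLin A))ᗮ (WithLp.toLp 2 v)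
  rw [← toLp_one_sub_projMatrix_mulVec, EuclideanSpace.inner_toLp_toLp] at h
  simpa using h

theorem finrank_range_permDesign {n p : ℕ} (π : Equiv.Perm (Fin n))
    (X : Matrix (Fin n) (Fin p) ℝ) :
    Module.finrank ℝ (LinearMap.range (Matrix.toEuclideanLin (permDesign π X))) = X.rank := by
  refine (Matrix.rank_eq_finrank_range_toLin (permDesign π X) (PiLp.basisFun 2 ℝ (Fin n))
    (PiLp.basisFun 2 ℝ (Fin p))).symm.trans ?_
  rw [permDesign, Matrix.rank_mul_eq_right_of_isUnit_det]
  rw [Matrix.det_permutation]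
  exact ((Equiv.Perm.sign π).isUnit.map (Int.castRingHom ℝ))

/-- The residual at the true parameters is `σu`, and `σ²` cancels in the ratio. -/
theorem statT_response {n p : ℕ} (X : Matrix (Fin n) (Fin p) ℝ) (π : Equiv.Perm (Fin n))
    (β : Fin p → ℝ) {σ : ℝ} (hσ : σ ≠ 0) (u : Fin n → ℝ) :
    statT X (response X π β σ u) π β =
      (‖(LinearMap.range (Matrix.toEuclideanLin (permDesign π X))).starProjection
          (WithLp.toLp 2 u)‖ ^ 2 / p) /
        (‖(LinearMap.range (Matrix.toEuclideanLin (permDesign π X)))ᗮ.starProjection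
          (WithLp.toLp 2 u)‖ ^ 2 / ((n : ℝ) - p)) := by
  have hr : response X π β σ u - (permDesign π X).mulVec β = σ • u := by
    rw [response, add_sub_cancel_left]
  simp only [statT, hr]
  rw [dotProduct_projMatrix_mulVec, dotProduct_one_sub_projMatrix_mulVec, WithLp.toLp_smul,
    map_smul, map_smul, norm_smul, norm_smul, mul_pow, mul_pow, mul_div_assoc,
    mul_div_assoc (‖σ‖ ^ 2) _ ((n : ℝ) - p), mul_div_mul_left]
  exact pow_ne_zero 2 (norm_ne_zero_iff.2 hσ)

/-- At the true parameters, the statistic `T` is `F`-distributed. -/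
theorem stdNormal_map_statT {n p : ℕ} {X : Matrix (Fin n) (Fin p) ℝ} (hX : X.rank = p)
    (hpn : p ≤ n) (π : Equiv.Perm (Fin n)) (β : Fin p → ℝ) {σ : ℝ} (hσ : σ ≠ 0) :
    (stdNormal n).map (fun u => statT X (response X π β σ u) π β) = fDist p (n - p) := by
  set V := LinearMap.range (Matrix.toEuclideanLin (permDesign π X)) with hV
  have ha : Module.finrank ℝ V = p := (finrank_range_permDesign π X).trans hX
  have hb : Module.finrank ℝ Vᗮ = n - p := by
    have := Submodule.finrank_add_finrank_orthogonal V
    rw [finrank_euclideanSpace_fin] at this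
    omega
  have h := stdGaussian_map_norm_sq_starProjection V ha hb
  have hg : Measurable fun q : ℝ × ℝ => (q.1 / p) / (q.2 / ((n - p : ℕ) : ℝ)) := by fun_prop
  have e : (fun u => statT X (response X π β σ u) π β) =
      (fun q : ℝ × ℝ => (q.1 / p) / (q.2 / ((n - p : ℕ) : ℝ))) ∘
        (fun x => (‖V.starProjection x‖ ^ 2, ‖Vᗮ.starProjection x‖ ^ 2)) ∘ WithLp.toLp 2 := by
    funext u
    rw [statT_response X π β hσ u]
    simp only [Function.comp_apply, Nat.cast_sub hpn]
    rfl
  rw [e, ← Measure.map_map hg (by fun_prop), ← Measure.map_map (by fun_prop) (by fun_prop),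
    stdNormal_map_toLp, h, Measure.map_map hg (measurable_prodMk_sqNorm _ _)]
  rfl

theorem measurable_statT_response {n p : ℕ} (X : Matrix (Fin n) (Fin p) ℝ)
    (π : Equiv.Perm (Fin n)) (β : Fin p → ℝ) {σ : ℝ} (hσ : σ ≠ 0) :
    Measurable fun u => statT X (response X π β σ u) π β := by
  simp only [statT_response X π β hσ]
  fun_prop

/-- The region of the true permutation has exact level; a union over candidates loses at most
the probability that the true permutation is not a candidate. -/
theorem sub_le_jointLaw_real_mem_coefRegion {n p L : ℕ} {X : Matrix (Fin n) (Fin p) ℝ}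
    (hX : X.rank = p) (hpn : p ≤ n) (π₀ : Equiv.Perm (Fin n)) (β₀ : Fin p → ℝ) {σ : ℝ}
    (hσ : σ ≠ 0) (sel : (Fin n → ℝ) → (Fin n → ℝ) → Equiv.Perm (Fin n)) {δ : ℝ}
    (hδ : (jointLaw n L).real
      {w | π₀ ∉ candidateSet sel (response X π₀ β₀ σ w.2) w.1} ≤ δ) {α : ℝ} (hα : α < 1) :
    α - δ ≤ (jointLaw n L).real {w | β₀ ∈ coefRegion X α (response X π₀ β₀ σ w.2)
      (candidateSet sel (response X π₀ β₀ σ w.2) w.1)} := by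
  have := isProbabilityMeasure_fDist p (n - p)
  set A : Set (Fin n → ℝ) := (fun u => statT X (response X π₀ β₀ σ u) π₀ β₀) ⁻¹'
    Set.Iic (quantile (fDist p (n - p)) α) with hA
  have h1 : α ≤ (jointLaw n L).real {w | w.2 ∈ A} := by
    rw [jointLaw_real_preimage_snd, hA, ← map_measureReal_apply
      (measurable_statT_response X π₀ β₀ hσ) measurableSet_Iic, stdNormal_map_statT hX hpn _ _ hσ]
    exact le_real_Iic_quantile _ hα
  have hsub : {w : (Fin L → Fin n → ℝ) × (Fin n → ℝ) | w.2 ∈ A} ⊆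
      {w | β₀ ∈ coefRegion X α (response X π₀ β₀ σ w.2)
        (candidateSet sel (response X π₀ β₀ σ w.2) w.1)} ∪
      {w | π₀ ∉ candidateSet sel (response X π₀ β₀ σ w.2) w.1} := by
    intro w hw
    by_cases hmem : π₀ ∈ candidateSet sel (response X π₀ β₀ σ w.2) w.1
    · exact Or.inl (Set.mem_iUnion₂.2 ⟨π₀, hmem, hw⟩)
    · exact Or.inr hmem
  have h2 := (measureReal_mono (μ := jointLaw n L) hsub).trans (measureReal_union_le _ _)
  linarith

/-! ### Choice of parameters and rate -/

/-- Choice of the tuning parameters in the nonasymptotic bound. -/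
theorem exists_rate {n p : ℕ} (hn : p + 1 < n) (hp : 0 < p) {c σ κ M G : ℝ} (hc : 0 < c)
    (hσ : 0 < σ) (hκ : 0 < κ) (hM : 0 ≤ M) (hG : 0 ≤ G) :
    ∃ C : ℝ, 0 < C ∧ ∀ L : ℕ, 1 ≤ L →
      1 ≤ C * (L : ℝ) ^ (-(((n : ℝ) - p - 1) / (2 * ((n : ℝ) - 1)))) ∨
      ∃ R h ρ : ℝ, 0 < R ∧ 0 ≤ h ∧ h ≤ 1 ∧ 0 < ρ ∧ 2 * (n * (R * h)) ≤ ρ ∧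
        2 * σ * (n * (R * h)) + 4 * σ * (n * (R * h)) * (n * R + n * (R * h)) / ρ < c ∧
        n * (M * (R ^ (8 * n))⁻¹) + G * ρ ^ (n - p - 1) + Real.exp (-((κ * h) ^ n * L)) ≤
          C * (L : ℝ) ^ (-(((n : ℝ) - p - 1) / (2 * ((n : ℝ) - 1)))) := by
  have hn3 : (3 : ℝ) ≤ n := by exact_mod_cast (show 3 ≤ n by omega)
  have hp1 : (1 : ℝ) ≤ p := by exact_mod_cast hp
  have hpn : (p : ℝ) + 1 < n := by exact_mod_cast hn
  set γ : ℝ := ((n : ℝ) - p - 1) / (2 * ((n : ℝ) - 1)) with hγ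
  set g : ℝ := 1 / (2 * ((n : ℝ) - 1)) with hg
  set b : ℝ := 1 / (16 * (n : ℝ)) with hb
  -- The parameters will be `R = L^b`, `h = L^(-a)`, `ρ = K L^(-g)`. The choice of `a` makes `R²h =
  -- L^(-g)`, matching `ρ`, while `an ≤ 7/8` for `n ≥ 3` keeps `h^n L` growing.
  set a : ℝ := g + 2 * b with ha
  have hd : 0 < 2 * ((n : ℝ) - 1) := by linarith
  have hg0 : 0 < g := by positivity
  have hb0 : 0 < b := by positivity
  have ha0 : 0 < a := by positivity
  have hγ0 : 0 < γ := div_pos (by linarith) hd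
  have hγh : γ ≤ 1 / 2 := by
    rw [hγ, div_le_div_iff₀ hd two_pos]; linarith
  have hγg : γ = g * ((n - p - 1 : ℕ) : ℝ) := by
    rw [Nat.cast_sub (by omega), Nat.cast_sub (by omega), hγ, hg]
    push_cast
    ring
  have han : a * n ≤ 7 / 8 := by
    have h1 : g * n ≤ 3 / 4 := by
      rw [hg, div_mul_eq_mul_div, div_le_div_iff₀ hd (by norm_num)]; linarith
    have h2 : b * n = 1 / 16 := by rw [hb]; field_simp
    rw [ha]; linarith
  -- The summand `2n` yields `2nRh ≤ ρ`; the other makes the quotient in the smallness condition at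
  -- most `c/4`.
  set K : ℝ := 32 * σ * n ^ 2 / c + 2 * n with hK
  have hK0 : 0 < K := by positivity
  have hKn : 2 * (n : ℝ) ≤ K := by
    have : 0 ≤ 32 * σ * (n : ℝ) ^ 2 / c := by positivity
    linarith
  have hKc : 32 * σ * (n : ℝ) ^ 2 ≤ K * c := by
    have h1 : K * c = 32 * σ * (n : ℝ) ^ 2 + 2 * n * c := by
      rw [hK]; field_simp
    have : 0 ≤ 2 * (n : ℝ) * c := by positivity
    linarith
  have hev : ∀ᶠ L : ℕ in atTop, 2 * σ * n * (L : ℝ) ^ (-(g + b)) < c / 2 := by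
    have h1 : Tendsto (fun L : ℕ => 2 * σ * n * (L : ℝ) ^ (-(g + b))) atTop (nhds 0) := by
      have := ((tendsto_rpow_neg_atTop (show 0 < g + b by positivity)).comp
        tendsto_natCast_atTop_atTop).const_mul (2 * σ * n)
      simpa using this
    exact h1.eventually_lt_const (by positivity)
  obtain ⟨L₀, hL₀⟩ := eventually_atTop.1 hev
  -- The first summand makes the bound trivial for `L < L₀`; the rest are the constants of the three
  -- error terms.
  set C : ℝ := ((L₀ : ℝ) + 1) ^ γ + (n * M + G * K ^ (n - p - 1) + 24 / (κ ^ n) ^ 4) with hC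
  have hC1 : 0 ≤ n * M + G * K ^ (n - p - 1) + 24 / (κ ^ n) ^ 4 := by positivity
  have hC2 : 0 < ((L₀ : ℝ) + 1) ^ γ := by positivity
  refine ⟨C, by positivity, fun L hL => ?_⟩
  set x : ℝ := (L : ℝ) with hx
  have hx1 : 1 ≤ x := by rw [hx]; exact_mod_cast hL
  have hx0 : 0 < x := by linarith
  have hxγ : 0 < x ^ (-γ) := Real.rpow_pos_of_pos hx0 _
  rcases lt_or_ge L L₀ with hlt | hge
  · left
    have h1 : x ^ γ ≤ C := by
      have : x ≤ (L₀ : ℝ) + 1 := by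
        have : (L : ℝ) < L₀ := by exact_mod_cast hlt
        linarith
      have := Real.rpow_le_rpow hx0.le this hγ0.le
      linarith
    calc (1 : ℝ) = x ^ γ * x ^ (-γ) := by
          rw [← Real.rpow_add hx0]; simp
      _ ≤ _ := by gcongr
  · right
    have hsm := hL₀ L hge
    have hRh : x ^ b * x ^ (-a) = x ^ (-(g + b)) := by
      rw [← Real.rpow_add hx0]; congr 1; rw [ha]; ring
    have hRRh : x ^ b * x ^ (-(g + b)) = x ^ (-g) := by
      rw [← Real.rpow_add hx0]; congr 1; ring
    have hRb : 1 ≤ x ^ b := Real.one_le_rpow hx1 hb0.le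
    have hmono : x ^ (-(g + b)) ≤ x ^ (-g) :=
      Real.rpow_le_rpow_of_exponent_le hx1 (by linarith)
    have hh1 : x ^ (-a) ≤ 1 := Real.rpow_le_one_of_one_le_of_nonpos hx1 (by linarith)
    have hg1 : x ^ (-(g + b)) ≤ 1 := Real.rpow_le_one_of_one_le_of_nonpos hx1 (by linarith)
    have hpos1 : 0 < x ^ (-g) := Real.rpow_pos_of_pos hx0 _
    have hpos2 : 0 < x ^ (-(g + b)) := Real.rpow_pos_of_pos hx0 _
    refine ⟨x ^ b, x ^ (-a), K * x ^ (-g), by positivity, by positivity, hh1, by positivity,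
      ?_, ?_, ?_⟩
    · rw [hRh, ← mul_assoc]
      exact mul_le_mul hKn hmono hpos2.le hK0.le
    · rw [hRh]
      have h2 : 4 * σ * (n * x ^ (-(g + b))) * (n * x ^ b + n * x ^ (-(g + b))) /
          (K * x ^ (-g)) ≤ c / 4 := by
        rw [div_le_iff₀ (by positivity)]
        calc 4 * σ * (n * x ^ (-(g + b))) * (n * x ^ b + n * x ^ (-(g + b)))
            ≤ 4 * σ * (n * x ^ (-(g + b))) * (n * x ^ b + n * x ^ b) := by
              have := hg1.trans hRb
              refine mul_le_mul_of_nonneg_left ?_ (by positivity)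
              exact add_le_add_right (mul_le_mul_of_nonneg_left this (by positivity)) _
          _ = (32 * σ * (n : ℝ) ^ 2) / 4 * (x ^ b * x ^ (-(g + b))) := by ring
          _ ≤ (K * c) / 4 * (x ^ b * x ^ (-(g + b))) := by gcongr
          _ = c / 4 * (K * x ^ (-g)) := by rw [hRRh]; ring
      have h3 : 2 * σ * (n * x ^ (-(g + b))) < c / 2 := by
        rw [← mul_assoc]; exact hsm
      linarith
    -- The moment order `8n` fits `b = 1/(16n)`: `R^(8n) = x^(1/2)`, and `γ ≤ 1/2`.
    · have t1 : n * (M * ((x ^ b) ^ (8 * n))⁻¹) ≤ n * M * x ^ (-γ) := by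
        have : ((x ^ b) ^ (8 * n))⁻¹ ≤ x ^ (-γ) := by
          rw [← Real.rpow_mul_natCast hx0.le, ← Real.rpow_neg hx0.le]
          apply Real.rpow_le_rpow_of_exponent_le hx1
          have : b * ((8 * n : ℕ) : ℝ) = 1 / 2 := by
            push_cast
            rw [hb]
            field_simp
            norm_num
          linarith
        rw [← mul_assoc]
        gcongr
      have t2 : G * (K * x ^ (-g)) ^ (n - p - 1) = G * K ^ (n - p - 1) * x ^ (-γ) := by
        rw [mul_pow, ← Real.rpow_mul_natCast hx0.le (-g), hγg, neg_mul, mul_assoc]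
      -- From `exp y ≥ y⁴/4!`; the fourth power suffices since `4(1 - an) ≥ 1/2 ≥ γ`.
      have t3 : Real.exp (-((κ * x ^ (-a)) ^ n * x)) ≤ 24 / (κ ^ n) ^ 4 * x ^ (-γ) := by
        have e1 : (κ * x ^ (-a)) ^ n * x = κ ^ n * x ^ (1 - a * n) := by
          rw [mul_pow, ← Real.rpow_mul_natCast hx0.le, mul_assoc]
          congr 1
          nth_rewrite 2 [← Real.rpow_one x]
          rw [← Real.rpow_add hx0]
          congr 1
          ring
        set y := κ ^ n * x ^ (1 - a * n) with hy
        have hy0 : 0 < y := by positivity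
        have hexp := Real.pow_div_factorial_le_exp y hy0.le 4
        have e2 : y ^ 4 = (κ ^ n) ^ 4 * x ^ ((1 - a * n) * 4) := by
          rw [hy, mul_pow, ← Real.rpow_mul_natCast hx0.le]
          norm_num
        have e3 : x ^ γ ≤ x ^ ((1 - a * n) * 4) :=
          Real.rpow_le_rpow_of_exponent_le hx1 (by linarith)
        have e4 : (κ ^ n) ^ 4 * x ^ γ / 24 ≤ Real.exp y := by
          refine le_trans ?_ hexp
          rw [e2, show ((Nat.factorial 4 : ℕ) : ℝ) = 24 by norm_num [Nat.factorial]]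
          gcongr
        rw [e1, Real.exp_neg]
        refine (inv_anti₀ (by positivity) e4).trans (le_of_eq ?_)
        rw [Real.rpow_neg hx0.le]
        have : x ^ γ ≠ 0 := (Real.rpow_pos_of_pos hx0 _).ne'
        field_simp
      have hfin : (n * M + G * K ^ (n - p - 1) + 24 / (κ ^ n) ^ 4) * x ^ (-γ) ≤ C * x ^ (-γ) := by
        gcongr
        linarith
      calc _ ≤ n * M * x ^ (-γ) + G * K ^ (n - p - 1) * x ^ (-γ) +
            24 / (κ ^ n) ^ 4 * x ^ (-γ) := add_le_add (add_le_add t1 t2.le) t3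
        _ = (n * M + G * K ^ (n - p - 1) + 24 / (κ ^ n) ^ 4) * x ^ (-γ) := by ring
        _ ≤ _ := hfin

/-- Eventually `log L ≥ 1`, so the logarithmic factor only weakens the bound. -/
theorem rpow_neg_isBigO_log_rpow_div_rpow {s : ℝ} (hs : 0 ≤ s) (γ : ℝ) :
    (fun L : ℕ => (L : ℝ) ^ (-γ)) =O[atTop] fun L : ℕ => Real.log L ^ s / (L : ℝ) ^ γ := by
  have hlog : ∀ᶠ L : ℕ in atTop, 1 ≤ Real.log L :=
    (Real.tendsto_log_atTop.comp tendsto_natCast_atTop_atTop).eventually_ge_atTop 1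
  refine IsBigO.of_bound 1 ?_
  filter_upwards [hlog] with L h1
  have hγ : 0 ≤ (L : ℝ) ^ γ := by positivity
  have h2 : 1 ≤ Real.log L ^ s := Real.one_le_rpow h1 hs
  rw [Real.rpow_neg (Nat.cast_nonneg L), Real.norm_of_nonneg (by positivity),
    Real.norm_of_nonneg (by positivity), one_mul, ← one_div]
  gcongr

end PermutedRegression

end

/-! ### Main theorem -/

open PermutedRegression in
theorem theorem3 (n p k : ℕ) (hp : 0 < p) (hn : p + 1 < n)
    (X : Matrix (Fin n) (Fin p) ℝ) (hX : X.rank = p)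
    (π₀ : Equiv.Perm (Fin n)) (hπ₀ : π₀ ∈ sparsePerms n k)
    (β₀ : Fin p → ℝ) (σ₀ : ℝ) (hσ₀ : 0 < σ₀)
    (hC : 0 < Cmin X k π₀ β₀) :
    ∃ δ : ℕ → ℝ, (∀ L, 0 < δ L) ∧
      δ =O[atTop] (fun L : ℕ =>
        Real.log L ^ (((n : ℝ) - p) / 2) /
          (L : ℝ) ^ (((n : ℝ) - p - 1) / (2 * ((n : ℝ) - 1)))) ∧
      ∀ sel : (Fin n → ℝ) → (Fin n → ℝ) → Equiv.Perm (Fin n), IsArgminRule X k sel →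
        (∀ L : ℕ, 2 ≤ L →
          (jointLaw n L).real
            {w | π₀ ∉ candidateSet sel (response X π₀ β₀ σ₀ w.2) w.1} ≤ δ L) ∧
        (∀ L : ℕ, 1 ≤ L → ∀ α : ℝ, 0 < α → α < 1 →
          α - δ L ≤
            (jointLaw n L).real
              {w | β₀ ∈ coefRegion X α (response X π₀ β₀ σ₀ w.2)
                (candidateSet sel (response X π₀ β₀ σ₀ w.2) w.1)}) := by
  obtain ⟨c, hc0, hc⟩ := exists_pos_le_norm_sub_of_Cmin_pos hC
  obtain ⟨κ, hκ, hle⟩ := exists_pos_mul_le_gaussianReal_std_real_Icc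
  obtain ⟨M, hM, htail⟩ := exists_gaussianReal_std_tail_le (8 * n) (by omega)
  obtain ⟨C, hC0, hrate⟩ := exists_rate hn hp hc0 hσ₀ hκ hM
    (Nat.cast_nonneg (Fintype.card (Equiv.Perm (Fin n))))
  have hpn : (p : ℝ) + 1 < n := by exact_mod_cast hn
  set γ : ℝ := ((n : ℝ) - p - 1) / (2 * ((n : ℝ) - 1)) with hγ
  -- At `L = 0` the real power `0^(-γ)` is `0`, so a separate value keeps `δ` positive. The sequence
  -- is fixed before `sel` and `α`.
  refine ⟨fun L => if L = 0 then 1 else C * (L : ℝ) ^ (-γ), fun L => ?_, ?_, fun sel hsel => ?_⟩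
  · dsimp only
    split_ifs with h
    · exact one_pos
    · have : (0 : ℝ) < L := by exact_mod_cast Nat.pos_of_ne_zero h
      positivity
  · refine IsBigO.congr' ((rpow_neg_isBigO_log_rpow_div_rpow
      (show 0 ≤ ((n : ℝ) - p) / 2 by linarith) γ).const_mul_left C) ?_ EventuallyEq.rfl
    filter_upwards [eventually_ne_atTop 0] with L hL
    rw [if_neg hL]
  -- The bound is proved from `L = 1` on, since coverage is claimed there too.
  · have hfail : ∀ L : ℕ, 1 ≤ L → (jointLaw n L).real
        {w | π₀ ∉ candidateSet sel (response X π₀ β₀ σ₀ w.2) w.1} ≤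
        if L = 0 then 1 else C * (L : ℝ) ^ (-γ) := by
      intro L hL
      rw [if_neg (by omega)]
      rcases hrate L hL with h1 | ⟨R, h, ρ, hR, h0, h1, hρ, hρε, hsmall, hbound⟩
      · exact measureReal_le_one.trans h1
      · refine (jointLaw_real_notMem_candidateSet_le hπ₀ hc hσ₀ hκ hle h0 h1 hR hρ hρε hsmall
          hsel).trans (le_trans ?_ hbound)
        gcongr
        exact htail R hR
    refine ⟨fun L hL => hfail L (by omega), fun L hL α _ hα => ?_⟩
    exact sub_le_jointLaw_real_mem_coefRegion hX (by omega) π₀ β₀ hσ₀.ne' sel (hfail L hL) hα
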